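/- Let $S\subset\mathbb R^n$ be open, $F:S\to\mathbb R^n$ a $C^1$-mapping, $D\subset S$ compact and $0\le T<\infty$. Call $x:[0,T]\to S$ a rollout if it solves the autonomous equation $\dot x=F(x)$ on $[0,T]$, and assume that for every $x_0\in D$ the system can be simulated on the whole interval without blowing up or leaving $S$, i.e. there is a rollout with $x(0)=x_0$. Let $\sigma:\mathbb R\to\mathbb R$ be a $C^1$ sigmoid, i.e. a nonconstant, monotonically increasing, bounded $C^1$ function (such as the logistic function or $\tanh$). An LTC network (without external input) with $n$ output units and $N$ hidden units has the state $z=(u,h)\in\mathbb R^{n}\times\mathbb R^{N}$ and the dynamics $$\dot z_i=-\Big[\frac1{\tau_i}+\sum_{j=1}^N f_{ij}(h)\Big]z_i+\sum_{j=1}^N f_{ij}(h)\,A_{ij},\qquad f_{ij}(h)=W_{ij}\,\sigma(\gamma_{ij}h_j+\mu_{ij}),\qquad i=1,\dots,n+N,$$ with time constants $\tau_i>0$ and real parameters $W_{ij},\gamma_{ij},\mu_{ij},A_{ij}$: hidden units are recurrently connected with each other and feed forward to the output units. Then for every $\varepsilon>0$ there are an $N$, an LTC network with $N$ hidden units and $n$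 output units, a matrix $B\in\mathbb R^{N\times n}$ and a vector $c\in\mathbb R^N$ such that for every rollout $x$ on $[0,T]$ with $x(0)\in D$, the network initialised at $u(0)=x(0)$, $h(0)=Bx(0)+c$ has a solution on $[0,T]$, and every such solution satisfies $$\max_{t\in[0,T]}|x(t)-u(t)|<\varepsilon .$$ This holds in both usual forms of the LTC equation: (a) the network can be chosen with $A_{ij}=A_i$ independent of $j$, so that its equation is $\dot z=-[1/\tau+f(z)]\odot z+f(z)\odot A$ with the vector-valued neural network $f_i=\sum_j f_{ij}$ and the vector $A$; and (b) another network (with its own $N$, $B$, $c$) can be chosen with nonnegative synaptic weights $W_{ij}\ge0$, where the constants $A_{ij}$ may differ from synapse to synapse. -/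

import Mathlib

/-- A `C¹` sigmoid: a nonconstant, monotonically increasing, bounded and continuously
differentiable function on the real line. -/
structure IsC1Sigmoid (σ : ℝ → ℝ) : Prop where
  contDiff : ContDiff ℝ 1 σ
  monotone : Monotone σ
  bounded : ∃ M : ℝ, ∀ s : ℝ, |σ s| ≤ M
  nonconstant : ∃ s t : ℝ, σ s ≠ σ t

/-- `x` is a rollout on `[0, T]` of the autonomous system `x' = F(x)` on `S`: it stays in `S`
and solves the equation on `[0, T]` (with one-sided derivatives at the end points). -/
def IsRollout {n : ℕ} (F : EuclideanSpace ℝ (Fin n) → EuclideanSpace ℝ (Fin n))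
    (S : Set (EuclideanSpace ℝ (Fin n))) (T : ℝ) (x : ℝ → EuclideanSpace ℝ (Fin n)) : Prop :=
  ∀ t ∈ Set.Icc (0 : ℝ) T, x t ∈ S ∧ HasDerivWithinAt x (F (x t)) (Set.Icc (0 : ℝ) T) t

/-- The parameters of a liquid time-constant (LTC) network without external input, with `n` output
units and `N` hidden units. The units are indexed by `Fin n ⊕ Fin N` (outputs, then hidden units).
The hidden units are recurrently connected, and feed forward to the output units: every unit `i`
receives a synapse from every hidden unit `j` (absent when `W i j = 0`), with weight `W i j`,
gain `γ i j`, bias `μ i j` and reversal constant `A i j`. -/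
structure LTCNetwork (n N : ℕ) where
  /-- time constants of the units -/
  τ : Fin n ⊕ Fin N → ℝ
  τ_pos : ∀ i, 0 < τ i
  W : Fin n ⊕ Fin N → Fin N → ℝ
  γ : Fin n ⊕ Fin N → Fin N → ℝ
  μ : Fin n ⊕ Fin N → Fin N → ℝ
  A : Fin n ⊕ Fin N → Fin N → ℝ

namespace LTCNetwork

variable {n N : ℕ}

/-- The nonlinearity of the synapse from the hidden unit `j` to the unit `i`, when the network is
in the state `z`: `f_ij(z) = W_ij σ(γ_ij h_j + μ_ij)` with `h_j` the state of the hidden unit. -/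
def synapse (P : LTCNetwork n N) (σ : ℝ → ℝ) (z : Fin n ⊕ Fin N → ℝ)
    (i : Fin n ⊕ Fin N) (j : Fin N) : ℝ :=
  P.W i j * σ (P.γ i j * z (Sum.inr j) + P.μ i j)

/-- The right-hand side of the LTC equation `z' = -[1/τ + f(z)] z + f(z) A`:
the `i`-th component is `-(1/τ_i + ∑ j, f_ij(z)) z_i + ∑ j, f_ij(z) A_ij`. -/
noncomputable def field (P : LTCNetwork n N) (σ : ℝ → ℝ) (z : Fin n ⊕ Fin N → ℝ) :
    Fin n ⊕ Fin N → ℝ :=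
  fun i => -(1 / P.τ i + ∑ j, P.synapse σ z i j) * z i + ∑ j, P.synapse σ z i j * P.A i j

/-- `z` is the state of the network on `[0, T]`, started at `z₀`. -/
def IsSolution (P : LTCNetwork n N) (σ : ℝ → ℝ) (T : ℝ) (z₀ : Fin n ⊕ Fin N → ℝ)
    (z : ℝ → Fin n ⊕ Fin N → ℝ) : Prop :=
  z 0 = z₀ ∧ ∀ t ∈ Set.Icc (0 : ℝ) T,
    HasDerivWithinAt z (P.field σ (z t)) (Set.Icc (0 : ℝ) T) t

/-- The states of the output units. -/
def output (z : Fin n ⊕ Fin N → ℝ) : EuclideanSpace ℝ (Fin n) :=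
  WithLp.toLp 2 (fun i => z (Sum.inl i))

/-- The initial state of the network for the initial value `x₀`: the output units start at `x₀`,
the hidden units at `B x₀ + c`. -/
def initState (B : Matrix (Fin N) (Fin n) ℝ) (c : Fin N → ℝ)
    (x₀ : EuclideanSpace ℝ (Fin n)) : Fin n ⊕ Fin N → ℝ :=
  Sum.elim (fun i => x₀ i) (fun k => (∑ i, B k i * x₀ i) + c k)

/-- With a suitable initialization, which depends on a rollout through its initial value only
(and affinely so), the network has a solution on `[0, T]`, and its output state stays
within `ε` of the rollout, for every rollout on `[0, T]` that starts in `D`. -/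
def Approximates (P : LTCNetwork n N) (σ : ℝ → ℝ)
    (F : EuclideanSpace ℝ (Fin n) → EuclideanSpace ℝ (Fin n))
    (S D : Set (EuclideanSpace ℝ (Fin n))) (T ε : ℝ) : Prop :=
  ∃ (B : Matrix (Fin N) (Fin n) ℝ) (c : Fin N → ℝ),
    ∀ x : ℝ → EuclideanSpace ℝ (Fin n), IsRollout F S T x → x 0 ∈ D →
      (∃ z, P.IsSolution σ T (initState B c (x 0)) z) ∧
      ∀ z, P.IsSolution σ T (initState B c (x 0)) z →
        ∀ t ∈ Set.Icc (0 : ℝ) T, ‖x t - output (z t)‖ < ε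

end LTCNetwork

/-! All rollouts from `D` stay in one compact subset of `S` (`exists_isCompact_rollout_mem`). On a
compact tube around it, `F` is uniformly close to a one-layer network `G v = V σ(B v + c)`
(`IsC1Sigmoid.exists_network_approx`). If `v' = G v`, then `h = B v + c` satisfies `h' = B V σ(h)`,
while `u = v` satisfies `u' = V σ(h)`. So `(u, h)` solves a recurrent system without leakage,
started at an affine function of `x 0`.

An LTC network imitates this system by taking time constants `R`, weights of order `1 / R` and
reversal constants of order `R`: the driving term does not depend on `R`, and the leakage is `O(1 /
R)` on bounded sets (`exists_perturbation_solutions`). Both errors are propagated by Grönwall's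
inequality in a tube (`norm_sub_le_of_lipschitzOnWith_tube`).

Only the product of weight and reversal constant matters in the limit. Splitting a coefficient `a`
as `a * 1` gives form (a), and as `|a| * sign a` form (b). -/

/-! ### Grönwall estimates, existence and compactness of trajectories. -/

/-- A trajectory of an ODE whose field is Lipschitz on a tube around it attracts every approximate
trajectory that starts nearby into the tube, provided the Grönwall bound is small. -/
theorem norm_sub_le_of_lipschitzOnWith_tube {E : Type*} [NormedAddCommGroup E] [NormedSpace ℝ E]
    {F : E → E} {L : NNReal} {K : Set E} (hF : LipschitzOnWith L F K) {x y y' : ℝ → E}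
    {T δ η ρ : ℝ} (hδ : 0 ≤ δ) (hη : 0 ≤ η)
    (hx : ∀ t ∈ Set.Icc 0 T, HasDerivWithinAt x (F (x t)) (Set.Icc 0 T) t)
    (hxK : ∀ t ∈ Set.Icc 0 T, Metric.closedBall (x t) ρ ⊆ K)
    (hy : ∀ t ∈ Set.Icc 0 T, HasDerivWithinAt y (y' t) (Set.Icc 0 T) t)
    (hy' : ∀ t ∈ Set.Icc 0 T, ‖y t - x t‖ ≤ ρ → ‖y' t - F (y t)‖ < η)
    (h0 : ‖y 0 - x 0‖ ≤ δ) (hρ : gronwallBound δ L η T ≤ ρ) :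
    ∀ t ∈ Set.Icc 0 T, ‖y t - x t‖ ≤ ρ := by
  have hmono : ∀ t ∈ Set.Icc 0 T, gronwallBound δ L η t ≤ ρ := fun t ht =>
    (gronwallBound_mono hδ hη L.2 ht.2).trans hρ
  intro t ht
  refine le_trans ?_ (hmono t ht)
  -- This comparison needs the derivative bound only at times when the error equals the Grönwall
  -- bound. The error is then at most `ρ`, so `y` is in `K` and no prior confinement is required.
  refine image_norm_le_of_norm_deriv_right_lt_deriv_boundary (f := fun t => y t - x t)
    (f' := fun t => y' t - F (x t)) (a := 0) (b := T) ?_ ?_ ?_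
    (fun s => hasDerivAt_gronwallBound δ L η s) ?_ ht
  · exact fun s hs => ((hy s hs).sub (hx s hs)).continuousWithinAt
  · intro s hs
    have hs' := Set.Ico_subset_Icc_self hs
    refine ((hy s hs').sub (hx s hs')).mono_of_mem_nhdsWithin ?_
    exact Icc_mem_nhdsGE_of_mem hs
  · simpa [gronwallBound_x0] using h0
  · intro s hs hs2
    have hs' := Set.Ico_subset_Icc_self hs
    have hle : ‖y s - x s‖ ≤ ρ := hs2.trans_le (hmono s hs')
    have h1 := hy' s hs' hle
    have hys : y s ∈ K := hxK s hs' (by simpa [dist_eq_norm] using hle)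
    have hxs : x s ∈ K := hxK s hs' (Metric.mem_closedBall_self ((norm_nonneg _).trans hle))
    have h2 := hF.norm_sub_le hys hxs
    calc ‖y' s - F (x s)‖ = ‖(y' s - F (y s)) + (F (y s) - F (x s))‖ := by congr 1; abel
      _ ≤ ‖y' s - F (y s)‖ + ‖F (y s) - F (x s)‖ := norm_add_le _ _
      _ < L * gronwallBound δ L η s + η := by rw [← hs2]; linarith

/-- The bound is continuous in `δ` and vanishes at `0`. One `δ` serves as tolerance for both the
initial value and the field. -/
theorem exists_pos_gronwallBound_le (L T : ℝ) {ρ : ℝ} (hρ : 0 < ρ) :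
    ∃ δ > 0, gronwallBound δ L δ T ≤ ρ := by
  have hc : Continuous fun δ => gronwallBound δ L δ T := by
    by_cases hL : L = 0
    · subst hL
      simp only [gronwallBound_K0]
      fun_prop
    · simp only [gronwallBound_of_K_ne_0 hL]
      fun_prop
  have h0 : gronwallBound 0 L 0 T < ρ := by rwa [gronwallBound_ε0_δ0]
  have := hc.continuousAt.eventually_lt (continuousAt_const (y := ρ)) h0
  obtain ⟨r, hr, h⟩ := Metric.eventually_nhds_iff.1 this
  refine ⟨r / 2, by positivity, (h ?_).le⟩
  rw [Real.dist_eq, sub_zero, abs_of_pos (by positivity)]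
  linarith

/-- A `C¹` field bounded by `C` on the ball of radius `C * T` has a solution on `[0, T]`
started at the centre of the ball. -/
theorem exists_hasDerivWithinAt_of_norm_le {E : Type*} [NormedAddCommGroup E] [NormedSpace ℝ E]
    [FiniteDimensional ℝ E] {v : E → E} (hv : ContDiff ℝ 1 v) {C T : ℝ} (hC : 0 ≤ C) (hT : 0 ≤ T)
    (z₀ : E) (hb : ∀ w ∈ Metric.closedBall z₀ (C * T), ‖v w‖ ≤ C) :
    ∃ z : ℝ → E, z 0 = z₀ ∧
      ∀ t ∈ Set.Icc 0 T, HasDerivWithinAt z (v (z t)) (Set.Icc 0 T) t := by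
  have : ProperSpace E := FiniteDimensional.proper ℝ E
  have : CompleteSpace E := FiniteDimensional.complete ℝ E
  obtain ⟨K, hK⟩ := hv.contDiffOn.exists_lipschitzOnWith one_ne_zero
    (convex_closedBall z₀ (C * T)) (isCompact_closedBall z₀ (C * T))
  lift C to NNReal using hC
  lift T to NNReal using hT
  have hp : IsPicardLindelof (fun _ => v) (tmin := 0) (tmax := T) ⟨0, by simp⟩ z₀ (C * T) 0 C K :=
    IsPicardLindelof.of_time_independent (by simpa using hb) (by simpa using hK) (by simp)
  obtain ⟨z, h0, hz⟩ := hp.exists_eq_forall_mem_Icc_hasDerivWithinAt₀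
  exact ⟨z, h0, hz⟩

/-- A `C¹` map on an open set is Lipschitz on compact subsets. -/
theorem ContDiffOn.exists_lipschitzOnWith_of_isCompact {E E' : Type*} [NormedAddCommGroup E]
    [NormedSpace ℝ E] [NormedAddCommGroup E'] [NormedSpace ℝ E'] {F : E → E'} {S K : Set E}
    (hF : ContDiffOn ℝ 1 F S) (hS : IsOpen S) (hK : IsCompact K) (hKS : K ⊆ S) :
    ∃ L, LipschitzOnWith L F K := by
  refine LocallyLipschitzOn.exists_lipschitzOnWith_of_compact hK fun x hx => ?_
  obtain ⟨L, t, ht, h⟩ :=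
    (hF.contDiffAt (hS.mem_nhds (hKS hx))).exists_lipschitzOnWith
  exact ⟨L, t, mem_nhdsWithin_of_mem_nhds ht, h⟩

/-- The rollouts that start in a compact set stay in a common compact subset of `S`. -/
theorem exists_isCompact_rollout_mem {n : ℕ} {S D : Set (EuclideanSpace ℝ (Fin n))}
    {F : EuclideanSpace ℝ (Fin n) → EuclideanSpace ℝ (Fin n)} {T : ℝ}
    (hS : IsOpen S) (hF : ContDiffOn ℝ 1 F S) (hD : IsCompact D)
    (hsim : ∀ x₀ ∈ D, ∃ x : ℝ → EuclideanSpace ℝ (Fin n), IsRollout F S T x ∧ x 0 = x₀) :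
    ∃ K ⊆ S, IsCompact K ∧ ∀ x, IsRollout F S T x → x 0 ∈ D → ∀ t ∈ Set.Icc 0 T, x t ∈ K := by
  -- A tube around one rollout from `x₀` traps every rollout that starts near `x₀`. Finitely many
  -- such tubes suffice for `D`.
  have key : ∀ x₀ ∈ D, ∃ U ∈ nhds x₀, ∃ K ⊆ S, IsCompact K ∧
      ∀ x, IsRollout F S T x → x 0 ∈ U → ∀ t ∈ Set.Icc 0 T, x t ∈ K := by
    intro x₀ hx₀
    obtain ⟨x, hx, rfl⟩ := hsim x₀ hx₀
    have hC : IsCompact (x '' Set.Icc 0 T) :=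
      isCompact_Icc.image_of_continuousOn fun t ht => (hx t ht).2.continuousWithinAt
    have hCS : x '' Set.Icc 0 T ⊆ S := by
      rintro _ ⟨t, ht, rfl⟩
      exact (hx t ht).1
    obtain ⟨r, hr, hrS⟩ := hC.exists_cthickening_subset_open hS hCS
    have hK := hC.cthickening (r := r)
    obtain ⟨L, hL⟩ := hF.exists_lipschitzOnWith_of_isCompact hS hK hrS
    obtain ⟨δ, hδ, hδr⟩ := exists_pos_gronwallBound_le L T hr
    refine ⟨_, Metric.closedBall_mem_nhds _ hδ, _, hrS, hK, fun y hy hy0 t ht => ?_⟩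
    have hball : ∀ t ∈ Set.Icc 0 T,
        Metric.closedBall (x t) r ⊆ Metric.cthickening r (x '' Set.Icc 0 T) := fun t ht =>
      Metric.closedBall_subset_cthickening (Set.mem_image_of_mem x ht) r
    refine hball t ht ?_
    rw [mem_closedBall_iff_norm]
    exact norm_sub_le_of_lipschitzOnWith_tube hL hδ.le hδ.le (fun t ht => (hx t ht).2) hball
      (fun t ht => (hy t ht).2) (fun t _ _ => by simpa using hδ)
      (by simpa [dist_eq_norm] using hy0) hδr t ht
  choose! U hU K hKS hK hUK using key
  obtain ⟨s, hs, hcov⟩ := hD.elim_nhds_subcover U hU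
  refine ⟨⋃ x ∈ s, K x, by simpa using fun x hx => hKS x (hs x hx),
    s.isCompact_biUnion fun x hx => hK x (hs x hx), fun x hx hx0 t ht => ?_⟩
  obtain ⟨p, hp, hxp⟩ := Set.mem_iUnion₂.1 (hcov hx0)
  exact Set.mem_biUnion hp (hUK p (hs p hp) x hx hxp t ht)

/-! ### Density of one-layer sigmoid networks. -/

/-- A sigmoid can be rescaled to any unit step, up to a small error outside of a neighbourhood of
the step. -/
theorem IsC1Sigmoid.exists_normalized {σ : ℝ → ℝ} (hσ : IsC1Sigmoid σ) :
    ∃ p q : ℝ, (∀ s, 0 ≤ p * σ s + q) ∧ (∀ s, p * σ s + q ≤ 1) ∧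
      ∀ κ > 0, ∃ R : ℝ, (∀ s, R ≤ s → 1 - κ ≤ p * σ s + q) ∧ ∀ s, s ≤ -R → p * σ s + q ≤ κ := by
  obtain ⟨M, hM⟩ := hσ.bounded
  have hbb : BddBelow (Set.range σ) := ⟨-M, by rintro _ ⟨s, rfl⟩; exact (abs_le.1 (hM s)).1⟩
  have hba : BddAbove (Set.range σ) := ⟨M, by rintro _ ⟨s, rfl⟩; exact (abs_le.1 (hM s)).2⟩
  have hta := tendsto_atTop_ciSup hσ.monotone hba
  have htb := tendsto_atBot_ciInf hσ.monotone hbb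
  have hle : ∀ s, σ s ≤ ⨆ i, σ i := le_ciSup hba
  have hge : ∀ s, ⨅ i, σ i ≤ σ s := ciInf_le hbb
  set a := ⨅ i, σ i
  set b := ⨆ i, σ i
  have hab : 0 < b - a := by
    obtain ⟨s, t, hst⟩ := hσ.nonconstant
    rcases lt_or_gt_of_ne hst with h | h
    · linarith [hge s, hle t]
    · linarith [hge t, hle s]
  have hform : ∀ s, (b - a)⁻¹ * σ s + -(b - a)⁻¹ * a = (σ s - a) / (b - a) := fun s => by
    field_simp
    ring
  refine ⟨(b - a)⁻¹, -(b - a)⁻¹ * a, fun s => ?_, fun s => ?_, fun κ hκ => ?_⟩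
  · rw [hform]
    exact div_nonneg (by linarith [hge s]) hab.le
  · rw [hform, div_le_one hab]
    linarith [hle s]
  · have hκ' : 0 < κ * (b - a) := mul_pos hκ hab
    obtain ⟨R₁, h₁⟩ := Filter.eventually_atTop.1 (hta.eventually_const_lt (u := b - κ * (b - a))
      (by linarith))
    obtain ⟨R₂, h₂⟩ := Filter.eventually_atBot.1 (htb.eventually_lt_const (u := a + κ * (b - a))
      (by linarith))
    refine ⟨max R₁ (-R₂), fun s hs => ?_, fun s hs => ?_⟩
    · rw [hform, le_div_iff₀ hab]
      linarith [h₁ s ((le_max_left _ _).trans hs)]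
    · rw [hform, div_le_iff₀ hab]
      linarith [h₂ s (by linarith [le_max_right R₁ (-R₂)])]

/-- Continuous functions on an interval are uniform limits of combinations of scaled and shifted
sigmoids. -/
theorem IsC1Sigmoid.exists_sum_approx {σ : ℝ → ℝ} (hσ : IsC1Sigmoid σ) {g : ℝ → ℝ}
    (hg : Continuous g) (M : ℝ) {ε : ℝ} (hε : 0 < ε) :
    ∃ (c₀ : ℝ) (m : ℕ) (α γ μ : ℕ → ℝ), ∀ s ∈ Set.Icc (-M) M,
      |c₀ + ∑ k ∈ Finset.range m, α k * σ (γ k * s + μ k) - g s| ≤ ε := by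
  rcases lt_or_ge M 0 with hM | hM
  · exact ⟨0, 0, 0, 0, 0, fun s hs => absurd (hs.1.trans hs.2) (by linarith)⟩
  obtain ⟨p, q, hp0, hp1, hstep⟩ := hσ.exists_normalized
  -- The grid node after a point of `[-M, M]` may exceed `M`, by at most the mesh `h ≤ 1`.
  obtain ⟨d, hd, hgd⟩ := Metric.uniformContinuousOn_iff_le.1
    ((isCompact_Icc (a := -M) (b := M + 1)).uniformContinuousOn_of_continuous hg.continuousOn)
    (ε / 3) (by positivity)
  obtain ⟨m, hm⟩ := exists_nat_gt ((2 * M) / min d 1)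
  have hd1 : 0 < min d 1 := by positivity
  have hm0 : (0 : ℝ) < m := lt_of_le_of_lt (by positivity) hm
  have hmd : 2 * M < m * min d 1 := by rwa [div_lt_iff₀ hd1] at hm
  set h := min d 1 with hh
  obtain ⟨R, hR1, hR2⟩ := hstep (1 / m) (by positivity)
  set x : ℕ → ℝ := fun k => -M + k * h with hx
  -- With this slope, a distance `h / 2` from the midpoint of a cell becomes `|R|`, where the
  -- sigmoid is within `1 / m` of its limit.
  set l := 2 * |R| / h
  have hl : l * (h / 2) = |R| := by simp only [l]; field_simp
  have hl0 : 0 ≤ l := by positivity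
  set θ : ℕ → ℝ → ℝ := fun k s => p * σ (l * s + -(l * (x k + h / 2))) + q with hθ
  set Δ : ℕ → ℝ := fun k => if k < m ∧ x k ≤ M then g (x (k + 1)) - g (x k) else 0 with hΔ
  have hxs : ∀ k, x (k + 1) = x k + h := fun k => by simp only [hx]; push_cast; ring
  have hxM : ∀ k, -M ≤ x k := fun k => by
    simp only [hx]
    have : 0 ≤ (k : ℝ) * h := by positivity
    linarith
  have hΔb : ∀ k, |Δ k| ≤ ε / 3 := by
    intro k
    simp only [hΔ]
    split_ifs with hk
    · refine hgd _ ⟨hxM _, ?_⟩ _ ⟨hxM _, by linarith⟩ ?_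
      · rw [hxs]; linarith [min_le_right d 1]
      · rw [hxs, Real.dist_eq, add_sub_cancel_left, abs_of_pos hd1]
        exact min_le_left _ _
    · simp only [abs_zero]; positivity
  refine ⟨g (x 0) + ∑ k ∈ Finset.range m, Δ k * q, m, fun k => Δ k * p, fun _ => l,
    fun k => -(l * (x k + h / 2)), fun s hs => ?_⟩
  have hsum : g (x 0) + ∑ k ∈ Finset.range m, Δ k * q +
      ∑ k ∈ Finset.range m, Δ k * p * σ (l * s + -(l * (x k + h / 2))) =
      g (x 0) + ∑ k ∈ Finset.range m, Δ k * θ k s := by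
    rw [add_assoc, ← Finset.sum_add_distrib]
    congr 1
    refine Finset.sum_congr rfl fun k _ => ?_
    simp only [hθ]
    ring
  rw [hsum]
  obtain ⟨j, hj1, hj2⟩ : ∃ j : ℕ, x j ≤ s ∧ s < x (j + 1) := by
    refine ⟨⌊(s + M) / h⌋₊, ?_, ?_⟩
    · have := Nat.floor_le (a := (s + M) / h) (div_nonneg (by linarith [hs.1]) hd1.le)
      rw [le_div_iff₀ hd1] at this
      simp only [hx]; linarith
    · have := Nat.lt_floor_add_one ((s + M) / h)
      rw [div_lt_iff₀ hd1] at this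
      simp only [hx]; push_cast; linarith
  have hjm : j < m := by
    have h1 : (j : ℝ) * h < m * h := by
      have := hs.2
      simp only [hx] at hj1
      linarith
    exact_mod_cast lt_of_mul_lt_mul_right h1 hd1.le
  have htel : g (x j) = g (x 0) + ∑ k ∈ Finset.range m, Δ k * (if k < j then 1 else 0) := by
    have h1 : ∑ k ∈ Finset.range m, Δ k * (if k < j then 1 else 0) =
        ∑ k ∈ Finset.range j, (g (x (k + 1)) - g (x k)) := by
      simp only [mul_ite, mul_one, mul_zero]
      rw [← Finset.sum_filter]
      have : (Finset.range m).filter (· < j) = Finset.range j := by ext; simp; omega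
      rw [this]
      refine Finset.sum_congr rfl fun k hk => ?_
      rw [Finset.mem_range] at hk
      have hxk : x k ≤ x j := by
        have : (k : ℝ) ≤ j := by exact_mod_cast hk.le
        simp only [hx]; gcongr
      exact if_pos ⟨hk.trans hjm, by linarith [hs.2]⟩
    rw [h1, Finset.sum_range_sub fun k => g (x k)]
    ring
  have hmon : ∀ i k : ℕ, i < k → x i + h ≤ x k := by
    intro i k hik
    have : (i : ℝ) + 1 ≤ k := by exact_mod_cast hik
    simp only [hx]; nlinarith
  -- Only the step in the cell of `s` may be off by as much as `1`. The others are off by `1 / m`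
  -- each, so the total is at most `2 * (ε / 3)`; the oscillation of `g` on the cell adds `ε / 3`.
  have hθ' : ∀ k ∈ Finset.range m, |Δ k * (θ k s - if k < j then 1 else 0)| ≤
      ε / 3 * (1 / m + if k = j then 1 else 0) := by
    intro k _
    rw [abs_mul]
    refine mul_le_mul (hΔb k) ?_ (abs_nonneg _) (by positivity)
    have b0 : 0 ≤ θ k s := hp0 _
    have b1 : θ k s ≤ 1 := hp1 _
    have hmi : 0 < 1 / (m : ℝ) := by positivity
    rcases lt_trichotomy k j with hkj | rfl | hkj
    · rw [if_pos hkj, if_neg hkj.ne]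
      have : 1 - 1 / m ≤ θ k s := hR1 _ (by
        have := mul_le_mul_of_nonneg_left (show h / 2 ≤ s - (x k + h / 2) by
          linarith [hmon k j hkj]) hl0
        linarith [le_abs_self R])
      rw [abs_le]; constructor <;> linarith
    · simp only [lt_irrefl, if_false, if_true, sub_zero]
      rw [abs_of_nonneg b0]; linarith
    · rw [if_neg hkj.not_gt, if_neg hkj.ne']
      have : θ k s ≤ 1 / m := hR2 _ (by
        have := mul_le_mul_of_nonneg_left (show h / 2 ≤ (x k + h / 2) - s by
          linarith [hmon j k hkj, hxs j]) hl0
        linarith [le_abs_self R])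
      rw [abs_le]; constructor <;> linarith
  have hmain : |∑ k ∈ Finset.range m, Δ k * (θ k s - if k < j then 1 else 0)| ≤ 2 * (ε / 3) := by
    refine (Finset.abs_sum_le_sum_abs _ _).trans ((Finset.sum_le_sum hθ').trans ?_)
    rw [← Finset.mul_sum, Finset.sum_add_distrib, Finset.sum_const, Finset.card_range,
      Finset.sum_ite_eq' (Finset.range m) j, if_pos (Finset.mem_range.2 hjm), nsmul_eq_mul,
      mul_one_div_cancel hm0.ne']
    linarith
  have hgs : |g (x j) - g s| ≤ ε / 3 := by
    refine hgd _ ⟨hxM _, by linarith [hs.2]⟩ _ ⟨hs.1, by linarith [hs.2]⟩ ?_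
    rw [Real.dist_eq, abs_le]
    have := hxs j
    constructor <;> linarith [min_le_left d 1]
  have hsplit : g (x 0) + ∑ k ∈ Finset.range m, Δ k * θ k s - g s =
      (∑ k ∈ Finset.range m, Δ k * (θ k s - if k < j then 1 else 0)) + (g (x j) - g s) := by
    rw [htel]
    simp only [mul_sub, Finset.sum_sub_distrib]
    ring
  rw [hsplit]
  exact (abs_add_le _ _).trans (by linarith)

/-- The span of the ridge functions `x ↦ σ(⟪w, x⟫ + b)` on a compact set is dense. -/
theorem IsC1Sigmoid.topologicalClosure_span_ridge {σ : ℝ → ℝ} (hσ : IsC1Sigmoid σ)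
    {E : Type*} [NormedAddCommGroup E] [InnerProductSpace ℝ E] (K : Set E) [CompactSpace K] :
    (Submodule.span ℝ (Set.range fun p : E × ℝ =>
      (⟨fun x : K => σ (inner ℝ p.1 (x : E) + p.2),
        hσ.contDiff.continuous.comp (by fun_prop)⟩ : C(K, ℝ)))).topologicalClosure = ⊤ := by
  set N := Submodule.span ℝ (Set.range fun p : E × ℝ =>
      (⟨fun x : K => σ (inner ℝ p.1 (x : E) + p.2),
        hσ.contDiff.continuous.comp (by fun_prop)⟩ : C(K, ℝ))) with hN
  have hridge : ∀ (w : E) (b : ℝ) (f : C(K, ℝ)),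
      (∀ x : K, f x = σ (inner ℝ w (x : E) + b)) → f ∈ N := by
    intro w b f hf
    refine Submodule.subset_span ⟨(w, b), ?_⟩
    ext x
    exact (hf x).symm
  have hconst : ∀ a : ℝ, ContinuousMap.const K a ∈ N := by
    intro a
    obtain ⟨s, hs⟩ : ∃ s, σ s ≠ 0 := by
      obtain ⟨s, t, hst⟩ := hσ.nonconstant
      by_contra! h
      exact hst ((h s).trans (h t).symm)
    have h1 : ContinuousMap.const K (σ s) ∈ N := hridge 0 s _ (by simp)
    have h2 := N.smul_mem (a / σ s) h1
    convert h2 using 1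
    ext x
    simp [hs]
  -- Exponentials of linear forms are closed under products, so their span is already an algebra. It
  -- separates points, and Stone–Weierstrass applies; each exponential needs only one-dimensional
  -- approximation.
  set ex : Multiplicative E →* C(K, ℝ) :=
    { toFun := fun w => ⟨fun x : K => Real.exp (inner ℝ w.toAdd (x : E)), by fun_prop⟩
      map_one' := by ext x; simp
      map_mul' := fun v w => by ext x; simp [inner_add_left, Real.exp_add] } with hex
  have hexp : ∀ w, ex w ∈ N.topologicalClosure := by
    intro w
    obtain ⟨M, hM⟩ := (isCompact_range (f := fun x : K => inner ℝ w.toAdd (x : E))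
      (by fun_prop)).isBounded.exists_norm_le
    refine Metric.mem_closure_iff.2 fun ε hε => ?_
    obtain ⟨c₀, m, α, γ, μ, h⟩ := hσ.exists_sum_approx Real.continuous_exp M (half_pos hε)
    refine ⟨ContinuousMap.const K c₀ + ∑ k ∈ Finset.range m,
      α k • (⟨fun x : K => σ (inner ℝ (γ k • w.toAdd) (x : E) + μ k),
        hσ.contDiff.continuous.comp (by fun_prop)⟩ : C(K, ℝ)), ?_, ?_⟩
    · exact N.add_mem (hconst c₀) (N.sum_mem fun k _ =>
        N.smul_mem _ (hridge (γ k • w.toAdd) (μ k) _ fun _ => rfl))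
    · refine lt_of_le_of_lt ((ContinuousMap.dist_le (half_pos hε).le).2 fun x => ?_)
        (half_lt_self hε)
      have := h (inner ℝ w.toAdd (x : E)) (abs_le.1 (hM _ ⟨x, rfl⟩))
      rw [dist_comm, Real.dist_eq]
      simpa [hex, ContinuousMap.sum_apply, real_inner_smul_left] using this
  have hadj : Subalgebra.toSubmodule (Algebra.adjoin ℝ (Set.range ex)) ≤
      N.topologicalClosure := by
    rw [Algebra.adjoin_eq_span, ← MonoidHom.coe_mrange, Submonoid.closure_eq, Submodule.span_le]
    rintro _ ⟨w, rfl⟩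
    exact hexp w
  have hsep : (Algebra.adjoin ℝ (Set.range ex)).SeparatesPoints := by
    intro x y hxy
    refine ⟨_, ⟨ex (Multiplicative.ofAdd ((x : E) - y)),
      Algebra.subset_adjoin ⟨_, rfl⟩, rfl⟩, fun h => hxy ?_⟩
    have h1 : inner ℝ ((x : E) - y) (x : E) = inner ℝ ((x : E) - y) (y : E) :=
      Real.exp_injective h
    have h2 : inner ℝ ((x : E) - y) ((x : E) - y) = 0 := by rw [inner_sub_right, h1, sub_self]
    exact Subtype.ext (sub_eq_zero.1 (inner_self_eq_zero.1 h2))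
  rw [eq_top_iff]
  intro f _
  have hf := ContinuousMap.continuousMap_mem_subalgebra_closure_of_separatesPoints _ hsep f
  exact closure_minimal hadj N.isClosed_topologicalClosure hf

theorem EuclideanSpace.norm_le_of_forall_abs_le {n : ℕ} {x : EuclideanSpace ℝ (Fin n)} {δ : ℝ}
    (h : ∀ i, |x i| ≤ δ) : ‖x‖ ≤ n * δ := by
  rw [← (EuclideanSpace.basisFun (Fin n) ℝ).sum_repr x]
  refine (norm_sum_le _ _).trans ((Finset.sum_le_sum (g := fun _ => δ) fun i _ => ?_).trans ?_)
  · simpa [norm_smul] using h i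
  · simp

/-- One hidden layer of sigmoids approximates continuous vector fields on compact sets. -/
theorem IsC1Sigmoid.exists_network_approx {σ : ℝ → ℝ} (hσ : IsC1Sigmoid σ) {n : ℕ}
    {K : Set (EuclideanSpace ℝ (Fin n))} (hK : IsCompact K)
    {F : EuclideanSpace ℝ (Fin n) → EuclideanSpace ℝ (Fin n)} (hF : ContinuousOn F K)
    {η : ℝ} (hη : 0 < η) :
    ∃ (N : ℕ) (B : Matrix (Fin N) (Fin n) ℝ) (c : Fin N → ℝ) (V : Fin n → Fin N → ℝ),
      ∀ x ∈ K, ‖WithLp.toLp 2 (fun i => ∑ j, V i j * σ ((∑ k, B j k * x k) + c j)) - F x‖ < η := by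
  have : CompactSpace K := isCompact_iff_compactSpace.1 hK
  obtain ⟨η', hη', hη'n⟩ : ∃ η' > 0, n * η' < η := ⟨η / (n + 1), by positivity, by
    rw [← mul_div_assoc, div_lt_iff₀ (by positivity)]; linarith⟩
  have key : ∀ i : Fin n, ∃ a : (EuclideanSpace ℝ (Fin n) × ℝ) →₀ ℝ, ∀ x ∈ K,
      |(∑ p ∈ a.support, a p * σ (inner ℝ p.1 x + p.2)) - F x i| ≤ η' := by
    intro i
    have hc : Continuous fun x : K => F x i :=
      (EuclideanSpace.proj (𝕜 := ℝ) i).continuous.comp (continuousOn_iff_continuous_domRestrict.1 hF)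
    have hmem : (⟨fun x : K => F x i, hc⟩ : C(K, ℝ)) ∈ _ :=
      (hσ.topologicalClosure_span_ridge K).ge Submodule.mem_top
    obtain ⟨f, hf, hfd⟩ := Metric.mem_closure_iff.1 hmem η' hη'
    obtain ⟨a, rfl⟩ := Finsupp.mem_span_range_iff_exists_finsupp.1 hf
    refine ⟨a, fun x hx => ?_⟩
    have h1 := (ContinuousMap.dist_apply_le_dist (⟨x, hx⟩ : K)).trans hfd.le
    rw [dist_comm, Real.dist_eq] at h1
    simpa [Finsupp.sum, ContinuousMap.sum_apply] using h1
  choose a ha using key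
  classical
  -- Merging the supports gives all components of `F` a common hidden layer.
  set s : Finset (EuclideanSpace ℝ (Fin n) × ℝ) := Finset.univ.biUnion fun i => (a i).support
  set e := s.equivFin
  refine ⟨s.card, fun j k => (e.symm j).1.1 k, fun j => (e.symm j).1.2,
    fun i j => a i (e.symm j).1, fun x hx => ?_⟩
  have hcoord : ∀ i, |(∑ j, a i (e.symm j).1 *
      σ ((∑ k, (e.symm j).1.1 k * x k) + (e.symm j).1.2)) - F x i| ≤ η' := by
    intro i
    convert ha i x hx using 3
    rw [e.symm.sum_comp (fun p : s => a i p.1 * σ ((∑ k, p.1.1 k * x k) + p.1.2)),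
      Finset.sum_coe_sort s (fun p => a i p * σ ((∑ k, p.1 k * x k) + p.2))]
    symm
    refine (Finset.sum_subset (Finset.subset_biUnion_of_mem (fun i => (a i).support)
      (Finset.mem_univ i)) fun p _ hp => by simp [Finsupp.notMem_support_iff.1 hp]).trans ?_
    refine Finset.sum_congr rfl fun p _ => ?_
    simp [PiLp.inner_apply, mul_comm]
  refine lt_of_le_of_lt ?_ hη'n
  exact EuclideanSpace.norm_le_of_forall_abs_le fun i => by simpa using hcoord i

/-! ### Leakage as a small perturbation. -/

/-- A small perturbation of a bounded `C¹` field has solutions on `[0, T]`, and they are close to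
those of the unperturbed field. -/
theorem exists_perturbation_solutions {E : Type*} [NormedAddCommGroup E] [NormedSpace ℝ E]
    [FiniteDimensional ℝ E] {H Q : E → E} (hH : ContDiff ℝ 1 H) (hQ : ContDiff ℝ 1 Q) {C : ℝ}
    (hC : ∀ w, ‖H w‖ ≤ C) {Z : Set E} (hZ : Bornology.IsBounded Z) {T ρ : ℝ} (hT : 0 ≤ T)
    (hρ : 0 < ρ) :
    ∃ R > 0, ∀ z₀ ∈ Z,
      (∃ z : ℝ → E, z 0 = z₀ ∧ ∀ t ∈ Set.Icc 0 T,
        HasDerivWithinAt z (H (z t) - (1 / R : ℝ) • Q (z t)) (Set.Icc 0 T) t) ∧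
      ∀ y z : ℝ → E, y 0 = z₀ → z 0 = z₀ →
        (∀ t ∈ Set.Icc 0 T, HasDerivWithinAt y (H (y t)) (Set.Icc 0 T) t) →
        (∀ t ∈ Set.Icc 0 T,
          HasDerivWithinAt z (H (z t) - (1 / R : ℝ) • Q (z t)) (Set.Icc 0 T) t) →
        ∀ t ∈ Set.Icc 0 T, ‖z t - y t‖ ≤ ρ := by
  have : ProperSpace E := FiniteDimensional.proper ℝ E
  have hC0 : 0 ≤ C := (norm_nonneg _).trans (hC 0)
  obtain ⟨M, hM⟩ := hZ.exists_norm_le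
  -- This ball contains the perturbed trajectories, whose speed is at most `C + 1`, and the
  -- `ρ`-tubes around the unperturbed ones.
  set r := M + (C + 1) * T + ρ with hr
  obtain ⟨L, hL⟩ := hH.contDiffOn.exists_lipschitzOnWith one_ne_zero
    (convex_closedBall (0 : E) r) (isCompact_closedBall (0 : E) r)
  obtain ⟨q, hq⟩ := (isCompact_closedBall (0 : E) r).exists_bound_of_continuousOn
    hQ.continuous.continuousOn
  obtain ⟨δ, hδ, hδρ⟩ := exists_pos_gronwallBound_le L T hρ
  -- `R > q` makes the perturbation at most `1`, for existence; `R > q / δ` makes it less than `δ`,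
  -- for Grönwall.
  obtain ⟨R, hR⟩ := exists_gt (max 0 (max q (q / δ)))
  have hR0 : 0 < R := (le_max_left _ _).trans_lt hR
  have hRq : q < R := ((le_max_left _ _).trans (le_max_right _ _)).trans_lt hR
  have hRδ : q / δ < R := ((le_max_right _ _).trans (le_max_right _ _)).trans_lt hR
  have hpert : ∀ w ∈ Metric.closedBall (0 : E) r, ‖(1 / R : ℝ) • Q w‖ ≤ q / R := by
    intro w hw
    rw [norm_smul, Real.norm_eq_abs, abs_of_pos (by positivity), one_div_mul_eq_div]
    gcongr
    exact hq w hw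
  refine ⟨R, hR0, fun z₀ hz₀ => ⟨?_, fun y z hy0 hz0 hy hz => ?_⟩⟩
  · refine exists_hasDerivWithinAt_of_norm_le (v := fun w => H w - (1 / R : ℝ) • Q w)
      (hH.sub (hQ.const_smul _)) (C := C + 1) (by positivity) hT z₀ fun w hw => ?_
    have hw' : w ∈ Metric.closedBall (0 : E) r := by
      rw [mem_closedBall_zero_iff]
      rw [mem_closedBall_iff_norm] at hw
      linarith [norm_le_norm_add_norm_sub' w z₀, hM z₀ hz₀]
    have h1 : q / R ≤ 1 := by rw [div_le_one hR0]; exact hRq.le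
    linarith [norm_sub_le (H w) ((1 / R : ℝ) • Q w), hC w, hpert w hw']
  · have hyM : ∀ t ∈ Set.Icc 0 T, ‖y t‖ ≤ M + C * T := by
      intro t ht
      have h1 := norm_image_sub_le_of_norm_deriv_le_segment' hy (fun s _ => hC (y s)) t ht
      have h2 : C * (t - 0) ≤ C * T := by gcongr; linarith [ht.2]
      have h3 := hM z₀ hz₀
      rw [hy0] at h1
      linarith [norm_le_norm_add_norm_sub' (y t) z₀]
    have hball : ∀ t ∈ Set.Icc 0 T, Metric.closedBall (y t) ρ ⊆ Metric.closedBall 0 r := by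
      intro t ht w hw
      rw [mem_closedBall_zero_iff]
      rw [mem_closedBall_iff_norm] at hw
      have := hyM t ht
      linarith [norm_le_norm_add_norm_sub' w (y t)]
    refine norm_sub_le_of_lipschitzOnWith_tube hL hδ.le hδ.le hy hball hz (fun t ht hzt => ?_)
      (by simp [hy0, hz0, hδ.le]) hδρ
    rw [sub_sub_cancel_left, norm_neg]
    refine (hpert _ (hball t ht (mem_closedBall_iff_norm.2 hzt))).trans_lt ?_
    rw [div_lt_iff₀ hδ] at hRδ
    rw [div_lt_iff₀ hR0]
    linarith

namespace LTCNetwork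

/-- The network with weights `U / R`, reversal constants `R * s` and time constants `R`. For large
`R` it is a small perturbation of the network `z' = ∑ j, U i j * s i j * σ(h_j)` without leakage. -/
noncomputable def ofScale {n N : ℕ} (U s : Fin n ⊕ Fin N → Fin N → ℝ) (R : ℝ) (hR : 0 < R) :
    LTCNetwork n N where
  τ _ := R
  τ_pos _ := hR
  W i j := U i j / R
  γ _ _ := 1
  μ _ _ := 0
  A i j := R * s i j

theorem field_ofScale {n N : ℕ} (U s : Fin n ⊕ Fin N → Fin N → ℝ) (R : ℝ) (hR : 0 < R)
    (σ : ℝ → ℝ) (z : Fin n ⊕ Fin N → ℝ) :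
    (ofScale U s R hR).field σ z = (fun i => ∑ j, U i j * s i j * σ (z (Sum.inr j))) -
      (1 / R : ℝ) • fun i => (1 + ∑ j, U i j * σ (z (Sum.inr j))) * z i := by
  ext i
  have h1 : ∑ j, U i j / R * σ (z (Sum.inr j)) = (1 / R) * ∑ j, U i j * σ (z (Sum.inr j)) := by
    rw [Finset.mul_sum]
    exact Finset.sum_congr rfl fun j _ => by ring
  have h2 : ∑ j, U i j / R * σ (z (Sum.inr j)) * (R * s i j) =
      ∑ j, U i j * s i j * σ (z (Sum.inr j)) :=
    Finset.sum_congr rfl fun j _ => by field_simp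
  simp only [field, synapse, ofScale, one_mul, add_zero, Pi.sub_apply, Pi.smul_apply, smul_eq_mul]
  rw [h1, h2]
  ring

end LTCNetwork

theorem IsC1Sigmoid.exists_norm_sum_le {σ : ℝ → ℝ} (hσ : IsC1Sigmoid σ) {ι κ : Type*} [Fintype ι]
    [Fintype κ] (V : ι → κ → ℝ) :
    ∃ C : ℝ, 0 ≤ C ∧ ∀ s : κ → ℝ, ∀ i, |∑ j, V i j * σ (s j)| ≤ C := by
  obtain ⟨M, hM⟩ := hσ.bounded
  have hM0 : 0 ≤ M := (abs_nonneg _).trans (hM 0)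
  refine ⟨∑ i, ∑ j, |V i j| * M, by positivity, fun s i => ?_⟩
  calc |∑ j, V i j * σ (s j)| ≤ ∑ j, |V i j * σ (s j)| := Finset.abs_sum_le_sum_abs _ _
    _ ≤ ∑ j, |V i j| * M := Finset.sum_le_sum fun j _ => by
        rw [abs_mul]
        exact mul_le_mul_of_nonneg_left (hM _) (abs_nonneg _)
    _ ≤ ∑ i, ∑ j, |V i j| * M := Finset.single_le_sum (f := fun i => ∑ j, |V i j| * M)
        (fun i _ => by positivity) (Finset.mem_univ i)

/-! ### Assembly of the approximating network. -/

/-- Approximating networks, for a given way `a = u a * r a` of splitting a coefficient into a weight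
and a reversal constant. -/
theorem exists_ofScale_approximates {n : ℕ} {S D : Set (EuclideanSpace ℝ (Fin n))}
    {F : EuclideanSpace ℝ (Fin n) → EuclideanSpace ℝ (Fin n)} {T : ℝ}
    {σ : ℝ → ℝ} (hσ : IsC1Sigmoid σ)
    (hS : IsOpen S) (hF : ContDiffOn ℝ 1 F S) (hD : IsCompact D) (hT : 0 ≤ T)
    (hsim : ∀ x₀ ∈ D, ∃ x : ℝ → EuclideanSpace ℝ (Fin n), IsRollout F S T x ∧ x 0 = x₀)
    {ε : ℝ} (hε : 0 < ε) {u r : ℝ → ℝ} (hur : ∀ a, u a * r a = a) :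
    ∃ (N : ℕ) (V : Fin n ⊕ Fin N → Fin N → ℝ) (R : ℝ) (hR : 0 < R),
      (LTCNetwork.ofScale (fun i j => u (V i j)) (fun i j => r (V i j)) R hR).Approximates
        σ F S D T ε := by
  obtain ⟨K₀, hK₀S, hK₀, hroll⟩ := exists_isCompact_rollout_mem hS hF hD hsim
  obtain ⟨ρ₀, hρ₀, hρ₀S⟩ := hK₀.exists_cthickening_subset_open hS hK₀S
  obtain ⟨ρ, hρ, hρρ₀, hρε⟩ : ∃ ρ > 0, ρ ≤ ρ₀ ∧ ρ ≤ ε / 3 :=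
    ⟨min ρ₀ (ε / 3), by positivity, min_le_left _ _, min_le_right _ _⟩
  have hKS : Metric.cthickening ρ K₀ ⊆ S := (Metric.cthickening_mono hρρ₀ _).trans hρ₀S
  have hK := hK₀.cthickening (r := ρ)
  set K := Metric.cthickening ρ K₀
  obtain ⟨L, hL⟩ := hF.exists_lipschitzOnWith_of_isCompact hS hK hKS
  obtain ⟨δ, hδ, hδρ⟩ := exists_pos_gronwallBound_le L T hρ
  obtain ⟨N, B, c, V, hV⟩ := hσ.exists_network_approx hK (hF.continuousOn.mono hKS) hδ
  set G : EuclideanSpace ℝ (Fin n) → EuclideanSpace ℝ (Fin n) := fun v =>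
    WithLp.toLp 2 (fun i => ∑ j, V i j * σ ((∑ k, B j k * v k) + c j)) with hG
  have hσ1 := hσ.contDiff
  have hGc : ContDiff ℝ 1 G := by
    refine (contDiff_euclidean (𝕜 := ℝ)).2 fun i => ?_
    simp only [hG]
    refine ContDiff.sum fun j _ => contDiff_const.mul (hσ1.comp (ContDiff.add ?_ contDiff_const))
    exact ContDiff.sum fun k _ => contDiff_const.mul (EuclideanSpace.proj (𝕜 := ℝ) k).contDiff
  obtain ⟨C, hC0, hC⟩ := hσ.exists_norm_sum_le V
  have hGb : ∀ v, ‖G v‖ ≤ n * C := fun v =>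
    EuclideanSpace.norm_le_of_forall_abs_le fun i => hC (fun j => (∑ k, B j k * v k) + c j) i
  -- The lower block is `B V`, the recurrent matrix of `h = B v + c`.
  set V' : Fin n ⊕ Fin N → Fin N → ℝ := Sum.elim V fun k j => ∑ i, B k i * V i j with hV'
  set H : (Fin n ⊕ Fin N → ℝ) → Fin n ⊕ Fin N → ℝ := fun z i =>
    ∑ j, u (V' i j) * r (V' i j) * σ (z (Sum.inr j)) with hH
  set Q : (Fin n ⊕ Fin N → ℝ) → Fin n ⊕ Fin N → ℝ := fun z i =>
    (1 + ∑ j, u (V' i j) * σ (z (Sum.inr j))) * z i with hQ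
  have hHc : ContDiff ℝ 1 H := contDiff_pi.2 fun i =>
    ContDiff.sum fun j _ => contDiff_const.mul (hσ1.comp (contDiff_apply ℝ ℝ (Sum.inr j)))
  have hQc : ContDiff ℝ 1 Q := contDiff_pi.2 fun i =>
    (contDiff_const.add (ContDiff.sum fun j _ => contDiff_const.mul
      (hσ1.comp (contDiff_apply ℝ ℝ (Sum.inr j))))).mul (contDiff_apply ℝ ℝ i)
  obtain ⟨C', hC'0, hC'⟩ := hσ.exists_norm_sum_le fun i j => u (V' i j) * r (V' i j)
  have hHb : ∀ z, ‖H z‖ ≤ C' := fun z => (pi_norm_le_iff_of_nonneg hC'0).2 fun i =>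
    hC' (fun j => z (Sum.inr j)) i
  have hinit : Continuous (LTCNetwork.initState B c) := by
    refine continuous_pi fun i => ?_
    rcases i with i | i <;> simp only [LTCNetwork.initState, Sum.elim_inl, Sum.elim_inr] <;>
      fun_prop
  -- The state space carries the sup norm; the factor `n` pays for the passage to the Euclidean norm
  -- of the output.
  obtain ⟨ρ', hρ', hρ'n⟩ : ∃ ρ' > 0, n * ρ' ≤ ε / 3 := ⟨ε / 3 / (n + 1), by positivity, by
    rw [← mul_div_assoc, div_le_iff₀ (by positivity)]; linarith⟩
  obtain ⟨R, hR, hsol⟩ := exists_perturbation_solutions hHc hQc hHb (hD.image hinit).isBounded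
    hT hρ'
  refine ⟨N, V', R, hR, B, c, fun x hx hx0 => ?_⟩
  obtain ⟨hex, hclose⟩ := hsol _ ⟨x 0, hx0, rfl⟩
  simp only [LTCNetwork.IsSolution, LTCNetwork.field_ofScale]
  refine ⟨hex, fun z hz t ht => ?_⟩
  obtain ⟨v, hv0, hv⟩ := exists_hasDerivWithinAt_of_norm_le hGc (C := n * C) (by positivity) hT
    (x 0) fun w _ => hGb w
  have hball : ∀ t ∈ Set.Icc 0 T, Metric.closedBall (x t) ρ ⊆ K := fun t ht =>
    Metric.closedBall_subset_cthickening (hroll x hx hx0 t ht) ρ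
  have hvx := norm_sub_le_of_lipschitzOnWith_tube hL hδ.le hδ.le (fun t ht => (hx t ht).2) hball hv
    (fun t ht hvt => hV _ (hball t ht (mem_closedBall_iff_norm.2 hvt))) (by simp [hv0, hδ.le]) hδρ
    t ht
  have hlift : ∀ t ∈ Set.Icc 0 T, HasDerivWithinAt (fun t => LTCNetwork.initState B c (v t))
      (H (LTCNetwork.initState B c (v t))) (Set.Icc 0 T) t := by
    intro t ht
    have hvi : ∀ i, HasDerivWithinAt (fun t => v t i) (G (v t) i) (Set.Icc 0 T) t := fun i =>
      (EuclideanSpace.proj (𝕜 := ℝ) i).hasFDerivAt.comp_hasDerivWithinAt t (hv t ht)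
    refine hasDerivWithinAt_pi.2 fun i => ?_
    rcases i with i | k
    · simpa [hH, hG, hV', LTCNetwork.initState, hur] using hvi i
    · have h1 := (HasDerivWithinAt.fun_sum (u := Finset.univ)
        fun i _ => (hvi i).const_mul (B k i)).add_const (c k)
      refine h1.congr_deriv ?_
      simp only [hH, hG, hV', LTCNetwork.initState, hur, Sum.elim_inr, Finset.mul_sum,
        Finset.sum_mul]
      rw [Finset.sum_comm]
      simp only [mul_assoc]
  have hzy := hclose _ z (by simp [hv0]) hz.1 hlift hz.2 t ht
  have hout : ‖LTCNetwork.output (z t) - v t‖ ≤ n * ρ' :=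
    EuclideanSpace.norm_le_of_forall_abs_le fun i =>
      (norm_le_pi_norm (z t - LTCNetwork.initState B c (v t)) (Sum.inl i)).trans hzy
  have htri := norm_sub_le_norm_sub_add_norm_sub (x t) (v t) (LTCNetwork.output (z t))
  rw [norm_sub_rev (x t) (v t), norm_sub_rev (v t) (LTCNetwork.output (z t))] at htri
  linarith

theorem theorem3 (n : ℕ) (S D : Set (EuclideanSpace ℝ (Fin n)))
    (F : EuclideanSpace ℝ (Fin n) → EuclideanSpace ℝ (Fin n)) (T : ℝ)
    (σ : ℝ → ℝ) (hσ : IsC1Sigmoid σ)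
    (hS : IsOpen S) (hF : ContDiffOn ℝ 1 F S)
    (hD : IsCompact D) (hDS : D ⊆ S) (hT : 0 ≤ T)
    (hsim : ∀ x₀ ∈ D, ∃ x : ℝ → EuclideanSpace ℝ (Fin n), IsRollout F S T x ∧ x 0 = x₀)
    (ε : ℝ) (hε : 0 < ε) :
    (∃ (N : ℕ) (P : LTCNetwork n N),
      (∀ i, ∃ a : ℝ, ∀ j, P.A i j = a) ∧ P.Approximates σ F S D T ε) ∧
    (∃ (N : ℕ) (P : LTCNetwork n N),
      (∀ i j, 0 ≤ P.W i j) ∧ P.Approximates σ F S D T ε) := by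
  constructor
  · obtain ⟨N, V, R, hR, h⟩ := exists_ofScale_approximates hσ hS hF hD hT hsim hε
      (u := id) (r := fun _ => 1) (by simp)
    exact ⟨N, _, fun i => ⟨R * 1, fun j => rfl⟩, h⟩
  · obtain ⟨N, V, R, hR, h⟩ := exists_ofScale_approximates hσ hS hF hD hT hsim hε
      (u := fun a => |a|) (r := fun a => SignType.sign a) abs_mul_sign
    exact ⟨N, _, fun i j => div_nonneg (abs_nonneg _) hR.le, h⟩
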